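/- Let $S$ be a completely $0$-simple semigroup (a semigroup with zero $0$ such that $S^2\neq\{0\}$, the only two-sided ideals of $S$ are $\{0\}$ and $S$, and $S$ contains a primitive idempotent, i.e. a nonzero idempotent $e$ such that the only nonzero idempotent $f$ with $ef=fe=f$ is $f=e$) with more than two elements, and assume that $S$ is not the three-element semigroup obtained from the two-element right zero semigroup (with $xy=y$ for all $x,y$) by adjoining a zero. A right congruence on $S$ is an equivalence relation $\rho$ on $S$ such that $x\mathrel{\rho}y$ implies $xs\mathrel{\rho}ys$ for all $s\in S$; $S$ is called right irreducible if, for any two right congruences $\rho,\lambda$ on $S$, $\rho\cap\lambda=\Delta_S$ implies $\rho=\Delta_S$ or $\lambda=\Delta_S$, where $\Delta_S=\{(x,x): x\in S\}$. Then $S$ is right irreducible if and only if $S$ is a $0$-group, that is, $S\cong G\cup\{0\}$ for a group $G$ with a zero externally adjoined, such that any two nontrivial subgroups of $G$ have nontrivial intersection. -/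

import Mathlib

universe u

/-- A right congruence on a semigroup `S`, i.e. a congruence of the right `S`-act `S_S`:
an equivalence relation that is compatible with multiplication on the right. -/
structure RightCongruence (S : Type u) [Mul S] extends Setoid S where
  mul_right' : ∀ (s : S) {x y : S}, r x y → r (x * s) (y * s)

/-- A right congruence is diagonal if it relates no two distinct elements. -/
def RightCongruence.IsDiagonal {S : Type u} [Mul S] (ρ : RightCongruence S) : Prop :=
  ∀ x y : S, ρ.r x y → x = y

/-- `S` is right irreducible: if the intersection of two right congruences is the diagonal
relation, then one of the two is the diagonal relation. -/
def IsRightIrreducible (S : Type u) [Mul S] : Prop :=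
  ∀ ρ σ : RightCongruence S, (∀ x y : S, ρ.r x y ∧ σ.r x y → x = y) →
    ρ.IsDiagonal ∨ σ.IsDiagonal

/-- A (nonempty, two-sided) ideal of a semigroup. -/
structure IsSemigroupIdeal {S : Type u} [Mul S] (I : Set S) : Prop where
  nonempty : I.Nonempty
  mul_mem_left : ∀ (s : S) {x : S}, x ∈ I → s * x ∈ I
  mul_mem_right : ∀ (s : S) {x : S}, x ∈ I → x * s ∈ I

/-- A semigroup with zero is 0-simple if `S² ≠ {0}` and its only ideals are `{0}` and `S`. -/
structure IsZeroSimple (S : Type u) [SemigroupWithZero S] : Prop where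
  exists_mul_ne_zero : ∃ a b : S, a * b ≠ 0
  eq_zero_or_univ : ∀ I : Set S, IsSemigroupIdeal I → I = {0} ∨ I = Set.univ

/-- A primitive idempotent: a minimal nonzero idempotent for the natural order
`f ≤ e ↔ e * f = f ∧ f * e = f`. -/
structure IsPrimitiveIdempotent {S : Type u} [SemigroupWithZero S] (e : S) : Prop where
  idem : e * e = e
  ne_zero : e ≠ 0
  minimal : ∀ f : S, f * f = f → f ≠ 0 → e * f = f → f * e = f → f = e

/-- A completely 0-simple semigroup: 0-simple with a primitive idempotent. -/
structure IsCompletelyZeroSimple (S : Type u) [SemigroupWithZero S] : Prop where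
  zeroSimple : IsZeroSimple S
  exists_primitive : ∃ e : S, IsPrimitiveIdempotent e

/-- `S` is the two-element right zero semigroup (`x * y = y`) with a zero adjoined:
three elements, and every nonzero element acts on the left as the identity. -/
def IsRightZeroTwoWithZero (S : Type u) [SemigroupWithZero S] : Prop :=
  Nat.card S = 3 ∧ ∀ x y : S, x ≠ 0 → x * y = y

/-! In `G ∪ {0}` a right congruence is universal or comes from the subgroup of elements related to
1, which gives the criterion for 0-groups. Conversely, let `S` be irreducible with primitive
idempotent `e`. Collapsing right ideals shows that any two nonzero right ideals share a nonzero
element; as `e * S` is 0-minimal and `S = S * e * S`, this forces `e * S = S`. So `e` is a left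
identity and nonzero elements have right inverses. If `z * e ≠ z`, the two act alike on the left, so
the pair can be collapsed; irreducibility makes it the only such pair, and `S = {0, z * e, z}` is
the excluded semigroup. -/

namespace RightCongruence

/-- The right congruence collapsing a suitable set `R` to one class, all other classes being
singletons. -/
def collapse {S : Type u} [Mul S] (R : Set S)
    (hR : ∀ s : S, ∀ x ∈ R, ∀ y ∈ R, x * s = y * s ∨ (x * s ∈ R ∧ y * s ∈ R)) :
    RightCongruence S where
  r x y := x = y ∨ (x ∈ R ∧ y ∈ R)
  iseqv :=
    { refl := fun _ => Or.inl rfl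
      symm := by
        rintro x y (h | ⟨h, h'⟩)
        exacts [Or.inl h.symm, Or.inr ⟨h', h⟩]
      trans := by
        rintro x y z (rfl | ⟨h, h'⟩) (rfl | ⟨k, k'⟩)
        exacts [Or.inl rfl, Or.inr ⟨k, k'⟩, Or.inr ⟨h, h'⟩, Or.inr ⟨h, k'⟩] }
  mul_right' := by
    rintro s x y (rfl | ⟨h, h'⟩)
    exacts [Or.inl rfl, hR s x h y h']

/-- The pullback of a right congruence along a multiplicative isomorphism. -/
def comap {S T : Type u} [Mul S] [Mul T] (f : S ≃* T) (ρ : RightCongruence T) :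
    RightCongruence S where
  r x y := ρ.r (f x) (f y)
  iseqv :=
    { refl := fun _ => ρ.iseqv.refl _
      symm := fun h => ρ.iseqv.symm h
      trans := fun h k => ρ.iseqv.trans h k }
  mul_right' := by
    intro s x y h
    rw [map_mul, map_mul]
    exact ρ.mul_right' (f s) h

theorem isDiagonal_of_comap {S T : Type u} [Mul S] [Mul T] (f : S ≃* T)
    {ρ : RightCongruence T} (h : (ρ.comap f).IsDiagonal) : ρ.IsDiagonal := by
  intro x y hxy
  refine f.symm.injective (h _ _ ?_)
  change ρ.r (f (f.symm x)) (f (f.symm y))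
  simpa using hxy

/-- The right congruence on `G ∪ {0}` given by the right cosets of a subgroup. -/
def ofSubgroup {G : Type u} [Group G] (H : Subgroup G) : RightCongruence (WithZero G) where
  r x y := ∃ h ∈ H, x = (h : WithZero G) * y
  iseqv :=
    { refl := fun x => ⟨1, H.one_mem, by simp⟩
      symm := by
        rintro x y ⟨h, hh, rfl⟩
        refine ⟨h⁻¹, H.inv_mem hh, ?_⟩
        rw [← mul_assoc, ← WithZero.coe_mul]
        simp
      trans := by
        rintro x y z ⟨h, hh, rfl⟩ ⟨k, hk, rfl⟩
        exact ⟨h * k, H.mul_mem hh hk, by rw [WithZero.coe_mul, mul_assoc]⟩ }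
  mul_right' := by
    rintro s x y ⟨h, hh, rfl⟩
    exact ⟨h, hh, mul_assoc _ _ _⟩

theorem eq_bot_of_isDiagonal_ofSubgroup {G : Type u} [Group G] {H : Subgroup G}
    (h : (ofSubgroup H).IsDiagonal) : H = ⊥ := by
  rw [Subgroup.eq_bot_iff_forall]
  intro g hg
  exact WithZero.coe_injective (h g 1 ⟨g, hg, (mul_one _).symm⟩)

/-- The subgroup of elements related to the identity. -/
def toSubgroup {G : Type u} [Group G] (ρ : RightCongruence (WithZero G)) : Subgroup G where
  carrier := {g | ρ.r (g : WithZero G) 1}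
  one_mem' := ρ.iseqv.refl _
  mul_mem' := by
    intro a b ha hb
    have h := ρ.mul_right' (b : WithZero G) ha
    rw [one_mul, ← WithZero.coe_mul] at h
    exact ρ.iseqv.trans h hb
  inv_mem' := by
    intro a ha
    have h := ρ.mul_right' ((a⁻¹ : G) : WithZero G) ha
    rw [one_mul, ← WithZero.coe_mul, mul_inv_cancel] at h
    exact ρ.iseqv.symm h

theorem rel_of_coe_rel_zero {G : Type u} [Group G] {ρ : RightCongruence (WithZero G)} {g : G}
    (h : ρ.r (g : WithZero G) 0) (x y : WithZero G) : ρ.r x y := by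
  have h0 : ∀ x, ρ.r x 0 := by
    intro x
    have hx := ρ.mul_right' (((g⁻¹ : G) : WithZero G) * x) h
    rwa [← mul_assoc, ← WithZero.coe_mul, mul_inv_cancel, WithZero.coe_one, one_mul,
      zero_mul] at hx
  exact ρ.iseqv.trans (h0 x) (ρ.iseqv.symm (h0 y))

/-- If 0 is an isolated class, relating `g` to `k` relates `g * k⁻¹` to 1. -/
theorem universal_or_isDiagonal_or_toSubgroup_ne_bot {G : Type u} [Group G]
    (ρ : RightCongruence (WithZero G)) :
    (∀ x y, ρ.r x y) ∨ ρ.IsDiagonal ∨ ρ.toSubgroup ≠ ⊥ := by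
  by_contra! hc
  obtain ⟨⟨a, b, hab⟩, hd, hbot⟩ := hc
  refine hd fun x y hxy => ?_
  have hz : ∀ g : G, ¬ ρ.r (g : WithZero G) 0 := fun g hg => hab (rel_of_coe_rel_zero hg a b)
  induction x using WithZero.recZeroCoe <;> induction y using WithZero.recZeroCoe
  case zero.zero => rfl
  case zero.coe k => exact (hz k (ρ.iseqv.symm hxy)).elim
  case coe.zero g => exact (hz g hxy).elim
  case coe.coe g k =>
    have hm := ρ.mul_right' ((k⁻¹ : G) : WithZero G) hxy
    rw [← WithZero.coe_mul, ← WithZero.coe_mul, mul_inv_cancel] at hm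
    have hgk := (Subgroup.eq_bot_iff_forall _).1 hbot (g * k⁻¹) hm
    rw [mul_inv_eq_one.1 hgk]

end RightCongruence

open RightCongruence in
theorem IsRightIrreducible.of_mulEquiv {S T : Type u} [Mul S] [Mul T] (f : S ≃* T)
    (h : IsRightIrreducible S) : IsRightIrreducible T := by
  intro ρ σ hρσ
  refine (h (ρ.comap f) (σ.comap f) fun x y hxy => f.injective (hρσ _ _ hxy)).imp ?_ ?_
  · exact isDiagonal_of_comap f
  · exact isDiagonal_of_comap f

open RightCongruence in
theorem isRightIrreducible_withZero_iff {G : Type u} [Group G] :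
    IsRightIrreducible (WithZero G) ↔
      ∀ H K : Subgroup G, H ≠ ⊥ → K ≠ ⊥ → H ⊓ K ≠ ⊥ := by
  constructor
  · intro h H K hH hK hHK
    refine (h (ofSubgroup H) (ofSubgroup K) ?_).elim
      (fun hd => hH (eq_bot_of_isDiagonal_ofSubgroup hd))
      (fun hd => hK (eq_bot_of_isDiagonal_ofSubgroup hd))
    rintro x y ⟨⟨h, hh, hx⟩, ⟨k, hk, hx'⟩⟩
    rcases eq_or_ne y 0 with rfl | hy
    · rw [hx, mul_zero]
    · have hhk : h = k := WithZero.coe_injective (mul_right_cancel₀ hy (hx.symm.trans hx'))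
      have h1 := (Subgroup.eq_bot_iff_forall _).1 hHK h ⟨hh, hhk ▸ hk⟩
      rw [hx, h1, WithZero.coe_one, one_mul]
  · intro h ρ σ hρσ
    rcases ρ.universal_or_isDiagonal_or_toSubgroup_ne_bot with hρ | hρ | hρ
    · exact Or.inr fun x y hxy => hρσ x y ⟨hρ x y, hxy⟩
    · exact Or.inl hρ
    rcases σ.universal_or_isDiagonal_or_toSubgroup_ne_bot with hσ | hσ | hσ
    · exact Or.inl fun x y hxy => hρσ x y ⟨hxy, hσ x y⟩
    · exact Or.inr hσ
    refine (h _ _ hρ hσ ((Subgroup.eq_bot_iff_forall _).2 fun g hg => ?_)).elim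
    exact WithZero.coe_injective (hρσ g 1 hg)

/-- Otherwise the two collapses would meet in the diagonal. -/
theorem IsRightIrreducible.nontrivial_inter {S : Type u} [Mul S] (h : IsRightIrreducible S)
    {R T : Set S}
    (hR : ∀ s : S, ∀ x ∈ R, ∀ y ∈ R, x * s = y * s ∨ (x * s ∈ R ∧ y * s ∈ R))
    (hT : ∀ s : S, ∀ x ∈ T, ∀ y ∈ T, x * s = y * s ∨ (x * s ∈ T ∧ y * s ∈ T))
    (hR' : R.Nontrivial) (hT' : T.Nontrivial) : (R ∩ T).Nontrivial := by
  by_contra hc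
  rw [Set.not_nontrivial_iff] at hc
  rcases h (.collapse R hR) (.collapse T hT) (by
    rintro x y ⟨hx | ⟨hx, hy⟩, hx' | ⟨hx', hy'⟩⟩
    exacts [hx, hx, hx', hc ⟨hx, hx'⟩ ⟨hy, hy'⟩]) with hd | hd
  · obtain ⟨x, hx, y, hy, hxy⟩ := hR'
    exact hxy (hd x y (Or.inr ⟨hx, hy⟩))
  · obtain ⟨x, hx, y, hy, hxy⟩ := hT'
    exact hxy (hd x y (Or.inr ⟨hx, hy⟩))

/-! ### From a primitive idempotent to a group with zero -/

section CompletelyZeroSimple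

variable {S : Type u} [SemigroupWithZero S]

theorem IsZeroSimple.exists_eq_mul_mul (hS : IsZeroSimple S) {a : S} (ha : a ≠ 0) (z : S) :
    ∃ s t, z = s * a * t := by
  have hsq : ∀ z : S, ∃ s t, z = s * t := by
    have hI : IsSemigroupIdeal {z : S | ∃ s t, z = s * t} :=
      { nonempty := ⟨_, 0, 0, rfl⟩
        mul_mem_left := fun s x _ => ⟨s, x, rfl⟩
        mul_mem_right := fun s x _ => ⟨x, s, rfl⟩ }
    rcases hS.eq_zero_or_univ _ hI with h | h
    · obtain ⟨x, y, hxy⟩ := hS.exists_mul_ne_zero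
      have hm : x * y ∈ {z : S | ∃ s t, z = s * t} := ⟨x, y, rfl⟩
      rw [h] at hm
      exact (hxy hm).elim
    · intro z
      have hz : z ∈ {z : S | ∃ s t, z = s * t} := h ▸ Set.mem_univ z
      exact hz
  have hI : IsSemigroupIdeal {z : S | ∃ s t, z = s * a * t} :=
    { nonempty := ⟨_, 0, 0, rfl⟩
      mul_mem_left := by
        rintro s x ⟨u, v, rfl⟩
        exact ⟨s * u, v, by simp only [mul_assoc]⟩
      mul_mem_right := by
        rintro s x ⟨u, v, rfl⟩
        exact ⟨u, v * s, by simp only [mul_assoc]⟩ }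
  rcases hS.eq_zero_or_univ _ hI with h | h
  -- If `S * a * S = 0`, the ideal of such elements is all of `S`, contradicting `S = S² ≠ 0`.
  · have hann : IsSemigroupIdeal {x : S | ∀ s t, s * x * t = 0} :=
      { nonempty := ⟨0, by simp⟩
        mul_mem_left := fun u x hx s t => by rw [← mul_assoc, hx]
        mul_mem_right := fun u x hx s t => by rw [← mul_assoc, mul_assoc, hx] }
    have haA : a ∈ {x : S | ∀ s t, s * x * t = 0} := fun s t => by
      have hm : s * a * t ∈ {z : S | ∃ s t, z = s * a * t} := ⟨s, t, rfl⟩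
      rw [h] at hm
      exact hm
    rcases hS.eq_zero_or_univ _ hann with h' | h'
    · rw [h'] at haA
      exact (ha haA).elim
    · obtain ⟨x, y, hxy⟩ := hS.exists_mul_ne_zero
      obtain ⟨u, v, rfl⟩ := hsq x
      have hv : v ∈ {x : S | ∀ s t, s * x * t = 0} := h' ▸ Set.mem_univ v
      exact (hxy (hv u y)).elim
  · have hz : z ∈ {z : S | ∃ s t, z = s * a * t} := h ▸ Set.mem_univ z
    exact hz

/-- The right ideal generated by a primitive idempotent is `0`-minimal. -/
theorem IsPrimitiveIdempotent.exists_mul_eq (hS : IsZeroSimple S) {e : S}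
    (he : IsPrimitiveIdempotent e) {a : S} (ha : a ≠ 0) (hea : e * a = a) :
    ∃ w, a * w = e := by
  have hee := he.idem
  obtain ⟨x, y, hxy⟩ := hS.exists_eq_mul_mul ha e
  have hp : (e * x * e) * a * (y * e) = e := by
    calc (e * x * e) * a * (y * e) = e * (x * (e * a) * y) * e := by simp only [mul_assoc]
      _ = e := by rw [hea, ← hxy, hee, hee]
  set p := e * x * e with hp_def
  set q := y * e with hq_def
  have hqe : q * e = q := by rw [hq_def, mul_assoc, hee]
  have hpe : p * e = p := by rw [hp_def, mul_assoc, hee]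
  have hep : e * p = p := by rw [hp_def, ← mul_assoc, ← mul_assoc, hee]
  -- Since `p * a * q = e`, the element `a * (q * p)` is a nonzero idempotent below `e`.
  refine ⟨q * p, he.minimal _ ?_ ?_ ?_ ?_⟩
  · calc a * (q * p) * (a * (q * p)) = a * q * (p * a * q) * p := by simp only [mul_assoc]
      _ = a * (q * p) := by rw [hp, mul_assoc, hep, mul_assoc]
  · intro h0
    apply he.ne_zero
    calc e = (p * a * q) * (p * a * q) := by rw [hp, hee]
      _ = p * (a * (q * p)) * a * q := by simp only [mul_assoc]
      _ = 0 := by rw [h0, mul_zero, zero_mul, zero_mul]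
  · rw [← mul_assoc, hea]
  · rw [mul_assoc, mul_assoc, hpe]

theorem IsPrimitiveIdempotent.mul_eq_of_isRightIrreducible (hS : IsZeroSimple S)
    (h : IsRightIrreducible S) {e : S} (he : IsPrimitiveIdempotent e) (z : S) : e * z = z := by
  have hee := he.idem
  have hideal : ∀ a : S, ∀ s : S, ∀ x ∈ Set.range (a * ·), ∀ y ∈ Set.range (a * ·),
      x * s = y * s ∨ (x * s ∈ Set.range (a * ·) ∧ y * s ∈ Set.range (a * ·)) := by
    rintro a s _ ⟨x, rfl⟩ _ ⟨y, rfl⟩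
    exact Or.inr ⟨⟨x * s, (mul_assoc _ _ _).symm⟩, ⟨y * s, (mul_assoc _ _ _).symm⟩⟩
  have hnt : ∀ a : S, a * e ≠ 0 → (Set.range (a * ·)).Nontrivial := fun a ha =>
    ⟨a * e, ⟨e, rfl⟩, 0, ⟨0, mul_zero a⟩, ha⟩
  obtain ⟨s, t, rfl⟩ := hS.exists_eq_mul_mul he.ne_zero z
  rcases eq_or_ne (s * e) 0 with h0 | h0
  · rw [h0, zero_mul, mul_zero]
  have hse : s * e * e = s * e := by rw [mul_assoc, hee]
  -- A common nonzero element `s * e * u = e * v`, with `w` a right inverse of `e * u`, puts `s * e`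
  -- in `e * S`.
  have hex := h.nontrivial_inter (hideal (s * e)) (hideal e)
    (hnt _ (by rwa [hse])) (hnt _ (by rw [hee]; exact he.ne_zero))
  obtain ⟨c, ⟨⟨u, hu⟩, ⟨v, hv⟩⟩, hc⟩ := hex.exists_ne 0
  simp only at hu hv
  have heu : e * u ≠ 0 := fun h0 => hc (by rw [← hu, mul_assoc, h0, mul_zero])
  obtain ⟨w, hw⟩ := he.exists_mul_eq hS heu (by rw [← mul_assoc, hee])
  have hsw : s * e = e * (v * w) := by
    calc s * e = s * e * e := hse.symm
      _ = s * e * (e * u * w) := by rw [hw]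
      _ = s * (e * e) * u * w := by simp only [mul_assoc]
      _ = e * (v * w) := by rw [hee, hu, ← hv, mul_assoc]
  rw [hsw, ← mul_assoc, ← mul_assoc, hee]

/-- In a right group with zero which is right irreducible and not the two-element right zero
semigroup with zero adjoined, the left identity is also a right identity. -/
theorem IsRightIrreducible.mul_eq_of_left_identity (h : IsRightIrreducible S)
    (hexc : ¬ IsRightZeroTwoWithZero S) {e : S} (he0 : e ≠ 0) (hl : ∀ z, e * z = z)
    (hinv : ∀ a : S, a ≠ 0 → ∃ w, a * w = e) (z : S) : z * e = z := by
  -- `w * s` is a nonzero idempotent with a right inverse, hence a left identity.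
  have hcancel : ∀ s a b : S, s ≠ 0 → s * a = s * b → a = b := by
    intro s a b hs hab
    obtain ⟨w, hw⟩ := hinv s hs
    have hws : w * s ≠ 0 := fun h0 => hs (by
      rw [← hl s, ← hw, mul_assoc, h0, mul_zero])
    have hid : w * s * (w * s) = w * s := by
      rw [mul_assoc, ← mul_assoc s, hw, hl]
    obtain ⟨u, hu⟩ := hinv _ hws
    have hleft : ∀ x, w * s * x = x := fun x => by
      rw [← hl x, ← hu, ← mul_assoc, ← mul_assoc, hid]
    rw [← hleft a, ← hleft b, mul_assoc, hab, mul_assoc]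
  by_contra hz
  set x := z * e with hx
  have hxe : x * e = x := by rw [hx, mul_assoc, hl]
  have hz0 : z ≠ 0 := fun h0 => hz (by rw [hx, h0, zero_mul])
  have hx0 : x ≠ 0 := fun h0 => he0 (hcancel z e 0 hz0 (by rw [mul_zero, ← h0, hx]))
  have hpair : ∀ u v : S, (∀ s, u * s = v * s) → ∀ s, ∀ a ∈ ({u, v} : Set S),
      ∀ b ∈ ({u, v} : Set S), a * s = b * s ∨ (a * s ∈ ({u, v} : Set S) ∧
        b * s ∈ ({u, v} : Set S)) := by
    rintro u v huv s a (rfl | rfl) b (rfl | rfl)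
    exacts [Or.inl rfl, Or.inl (huv s), Or.inl (huv s).symm, Or.inl rfl]
  have hxz : ∀ s, x * s = z * s := fun s => by rw [hx, mul_assoc, hl]
  have huniq : ∀ u v : S, (∀ s, u * s = v * s) → u ≠ v →
      (u = x ∧ v = z) ∨ (u = z ∧ v = x) := by
    intro u v huv hne
    obtain ⟨a, ⟨ha, ha'⟩, b, ⟨hb, hb'⟩, hab⟩ := h.nontrivial_inter (hpair x z hxz) (hpair u v huv)
      ⟨x, by simp, z, by simp, hz⟩ ⟨u, by simp, v, by simp, hne⟩
    simp only [Set.mem_insert_iff, Set.mem_singleton_iff] at ha ha' hb hb'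
    rcases ha with rfl | rfl <;> rcases hb with rfl | rfl <;> grind
  have hfix : ∀ s, s ≠ 0 → s * x = x ∧ s * z = z := by
    intro s hs
    rcases huniq (s * x) (s * z) (fun t => by
        rw [mul_assoc, hxz, mul_assoc])
      (fun h' => hz (hcancel s _ _ hs h')) with h' | ⟨h1, h2⟩
    · exact h'
    -- Swapping `x` and `z` is impossible: `s * x` is fixed by right multiplication by `e`, while
    -- `z` is not.
    · refine (hz ?_).elim
      calc x = s * x * e := by rw [h1, hx]
        _ = z := by rw [mul_assoc, hxe, h1]
  have hse : ∀ s, s ≠ 0 → s * e = e := by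
    intro s hs
    obtain ⟨w, hw⟩ := hinv x hx0
    rw [← hw, ← mul_assoc, (hfix s hs).1]
  have hxe' : x = e := hse z hz0
  have hall : ∀ s, s = 0 ∨ s = x ∨ s = z := by
    intro s
    by_contra! hs
    -- From `s * e = e`, `s` acts on the left as `e = x` does, so `s` lies in the unique pair.
    rcases huniq s e (fun t => by rw [← hse s hs.1, mul_assoc, hl]) (hxe' ▸ hs.2.1) with h' | h'
    exacts [hs.2.1 h'.1, hs.2.2 h'.1]
  refine hexc ⟨?_, ?_⟩
  · have hu : (Set.univ : Set S) = {0, x, z} := by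
      ext s
      simpa using hall s
    rw [← Set.ncard_univ, hu, Set.ncard_eq_three]
    exact ⟨0, x, z, hx0.symm, hz0.symm, hz, rfl⟩
  · intro s y hs
    rcases hall y with rfl | rfl | rfl
    exacts [mul_zero s, (hfix s hs).1, (hfix s hs).2]

/-- A semigroup with zero having a nonzero identity and right inverses of nonzero elements is a
group with zero. -/
theorem exists_mulEquiv_withZero {e : S} (he0 : e ≠ 0) (hl : ∀ z, e * z = z)
    (hr : ∀ z, z * e = z) (hinv : ∀ a : S, a ≠ 0 → ∃ w, a * w = e) :
    ∃ (G : Type u) (_ : Group G), Nonempty (S ≃* WithZero G) := by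
  classical
  choose f hf using hinv
  let _ : GroupWithZero S :=
    { (inferInstance : SemigroupWithZero S) with
      one := e
      one_mul := hl
      mul_one := hr
      inv := fun a => if ha : a = 0 then 0 else f a ha
      inv_zero := dif_pos rfl
      mul_inv_cancel := fun a ha => by
        change a * (if ha : a = 0 then 0 else f a ha) = e
        rw [dif_neg ha, hf]
      exists_pair_ne := ⟨e, 0, he0⟩ }
  exact ⟨Sˣ, inferInstance, ⟨WithZero.withZeroUnitsEquiv.symm⟩⟩

end CompletelyZeroSimple

theorem mainTheorem2 (S : Type u) [SemigroupWithZero S] (hS : IsCompletelyZeroSimple S)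
    (hcard : 2 < ENat.card S) (hexc : ¬ IsRightZeroTwoWithZero S) :
    IsRightIrreducible S ↔
      ∃ (G : Type u) (_ : Group G), Nonempty (S ≃* WithZero G) ∧
        ∀ H K : Subgroup G, H ≠ ⊥ → K ≠ ⊥ → H ⊓ K ≠ ⊥ := by
  constructor
  · intro h
    obtain ⟨e, he⟩ := hS.exists_primitive
    have hl := he.mul_eq_of_isRightIrreducible hS.zeroSimple h
    have hinv : ∀ a : S, a ≠ 0 → ∃ w, a * w = e := fun a ha =>
      he.exists_mul_eq hS.zeroSimple ha (hl a)
    obtain ⟨G, hG, ⟨φ⟩⟩ := exists_mulEquiv_withZero he.ne_zero hl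
      (h.mul_eq_of_left_identity hexc he.ne_zero hl hinv) hinv
    exact ⟨G, hG, ⟨φ⟩, isRightIrreducible_withZero_iff.1 (h.of_mulEquiv φ)⟩
  · rintro ⟨G, hG, ⟨φ⟩, h⟩
    exact (isRightIrreducible_withZero_iff.2 h).of_mulEquiv φ.symm
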